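/- Let $d_0,d_1,d_2,m$ be arbitrary dimensions, and let $X\in\mathbb{R}^{d_0\times m}$ and $Y\in\mathbb{R}^{d_2\times m}$ be arbitrary data matrices. For $A_1\in\mathbb{R}^{d_1\times d_0}$ and $A_2\in\mathbb{R}^{d_2\times d_1}$ let $$\mathcal{L}(A_1,A_2)=\tfrac12\,\|A_2A_1X-Y\|_F^2$$ be the square loss of the linear network with one hidden layer, where $\|\cdot\|_F$ is the Frobenius norm. A critical point of $\mathcal{L}$ is a point $(A_1,A_2)$ with $\nabla_{A_1}\mathcal{L}=0$ and $\nabla_{A_2}\mathcal{L}=0$, and a saddle point is a critical point each of whose neighbourhoods contains both a point with a strictly lower and a point with a strictly higher value of $\mathcal{L}$. Then: 1. every local minimum of $\mathcal{L}$ is also a global minimum; 2. every critical point $(A_1,A_2)$ of $\mathcal{L}$ that is not a global minimum and satisfies $A_2A_1X\neq 0$ is a saddle point. -/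

import Mathlib

open Topology

-- Matrices carry the Frobenius norm.
attribute [local instance] Matrix.frobeniusNormedAddCommGroup Matrix.frobeniusNormedSpace

namespace ShallowLinear

/-- The parameters `(A₁, A₂)` of a linear network with one hidden layer: input dimension `d₀`,
hidden dimension `d₁`, output dimension `d₂`. -/
abbrev Params (d₀ d₁ d₂ : ℕ) : Type :=
  Matrix (Fin d₁) (Fin d₀) ℝ × Matrix (Fin d₂) (Fin d₁) ℝ

/-- The square loss `½ ‖A₂ A₁ X - Y‖²` (Frobenius norm). -/
noncomputable def loss {d₀ d₁ d₂ m : ℕ} (X : Matrix (Fin d₀) (Fin m) ℝ)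
    (Y : Matrix (Fin d₂) (Fin m) ℝ) (A : Params d₀ d₁ d₂) : ℝ :=
  1 / 2 * ‖A.2 * A.1 * X - Y‖ ^ 2

/-- `A` is a critical point of the function `f` of the two weight matrices: both partial gradients,
with respect to `A₁` and with respect to `A₂`, exist and vanish. -/
def IsCriticalPoint {d₀ d₁ d₂ : ℕ} (f : Params d₀ d₁ d₂ → ℝ) (A : Params d₀ d₁ d₂) : Prop :=
  HasFDerivAt (fun B : Matrix (Fin d₁) (Fin d₀) ℝ => f (B, A.2))
      (0 : Matrix (Fin d₁) (Fin d₀) ℝ →L[ℝ] ℝ) A.1 ∧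
    HasFDerivAt (fun B : Matrix (Fin d₂) (Fin d₁) ℝ => f (A.1, B))
      (0 : Matrix (Fin d₂) (Fin d₁) ℝ →L[ℝ] ℝ) A.2

/-- `A` is a global minimum of `f` over the whole parameter space. -/
def IsGlobalMin {d₀ d₁ d₂ : ℕ} (f : Params d₀ d₁ d₂ → ℝ) (A : Params d₀ d₁ d₂) : Prop :=
  ∀ B, f A ≤ f B

/-- `A` is a saddle point of `f`: a critical point such that every neighbourhood of it contains both
a point with a strictly lower value and a point with a strictly higher value. -/
def IsSaddlePoint {d₀ d₁ d₂ : ℕ} (f : Params d₀ d₁ d₂ → ℝ) (A : Params d₀ d₁ d₂) : Prop :=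
  IsCriticalPoint f A ∧ ∀ U ∈ 𝓝 A, (∃ B ∈ U, f B < f A) ∧ ∃ B ∈ U, f A < f B

end ShallowLinear

/-! The loss is a convex quadratic in the product `A₂A₁`, with gradient `G = (A₂A₁X - Y)Xᵀ`, so `G =
0` already forces a global minimum. At a local minimum `A₂ᵀG = 0` and `GA₁ᵀ = 0`, and two cases
remain.

If `A₂` kills some `u ≠ 0`, a curve whose leading term has order three forces `G = 0`
(`productGradient_eq_zero_of_mul_eq_zero`).

If `A₂` is injective, let `Z = A₂A₁X` and let `E` be `Y - Z` projected to the row space of `X`. Then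
`E` and `Z` have orthogonal column spaces and orthogonal row spaces. The second order condition says
that no singular value of `E` exceeds one of `Z` on the range of `A₂`, so `Z` is a best
approximation of `Z + E` of rank at most `d₁`, as in Eckart–Young (`frobInner_le_of_projection`).

Hence a critical point that is not a global minimum has lower values nearby; rescaling `A₂` produces
the higher ones. -/

namespace ShallowLinear

open Matrix

/-! ### Frobenius inner product -/

section FrobeniusInner

variable {ι κ μ : Type*} [Fintype ι] [Fintype κ] [Fintype μ]

/-- The Frobenius inner product of two real matrices. -/
def frobInner (M N : Matrix ι κ ℝ) : ℝ := (Mᵀ * N).trace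

lemma frobInner_eq_sum (M N : Matrix ι κ ℝ) : frobInner M N = ∑ i, ∑ j, M i j * N i j := by
  rw [Finset.sum_comm]
  simp [frobInner, Matrix.trace, Matrix.mul_apply]

lemma frobInner_comm (M N : Matrix ι κ ℝ) : frobInner M N = frobInner N M := by
  simp [frobInner_eq_sum, mul_comm]

lemma frobInner_add_left (M M' N : Matrix ι κ ℝ) :
    frobInner (M + M') N = frobInner M N + frobInner M' N := by
  simp [frobInner, Matrix.add_mul]

lemma frobInner_add_right (M N N' : Matrix ι κ ℝ) :
    frobInner M (N + N') = frobInner M N + frobInner M N' := by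
  simp [frobInner, Matrix.mul_add]

lemma frobInner_sub_left (M M' N : Matrix ι κ ℝ) :
    frobInner (M - M') N = frobInner M N - frobInner M' N := by
  simp [frobInner, Matrix.sub_mul]

lemma frobInner_sub_right (M N N' : Matrix ι κ ℝ) :
    frobInner M (N - N') = frobInner M N - frobInner M N' := by
  simp [frobInner, Matrix.mul_sub]

lemma frobInner_neg_left (M N : Matrix ι κ ℝ) : frobInner (-M) N = -frobInner M N := by
  simp [frobInner]

lemma frobInner_neg_right (M N : Matrix ι κ ℝ) : frobInner M (-N) = -frobInner M N := by
  simp [frobInner]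

lemma frobInner_smul_left (c : ℝ) (M N : Matrix ι κ ℝ) :
    frobInner (c • M) N = c * frobInner M N := by
  simp [frobInner]

lemma frobInner_smul_right (c : ℝ) (M N : Matrix ι κ ℝ) :
    frobInner M (c • N) = c * frobInner M N := by
  simp [frobInner]

@[simp] lemma frobInner_zero_left (N : Matrix ι κ ℝ) : frobInner 0 N = 0 := by
  simp [frobInner]

@[simp] lemma frobInner_zero_right (N : Matrix ι κ ℝ) : frobInner N 0 = 0 := by
  simp [frobInner]

lemma frobInner_mul_left (A : Matrix ι μ ℝ) (M : Matrix μ κ ℝ) (N : Matrix ι κ ℝ) :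
    frobInner (A * M) N = frobInner M (Aᵀ * N) := by
  simp [frobInner, Matrix.mul_assoc]

lemma frobInner_mul_right (M : Matrix ι μ ℝ) (A : Matrix μ κ ℝ) (N : Matrix ι κ ℝ) :
    frobInner (M * A) N = frobInner M (N * Aᵀ) := by
  rw [frobInner, frobInner, Matrix.transpose_mul, Matrix.mul_assoc, Matrix.trace_mul_comm,
    Matrix.mul_assoc]

lemma frobInner_transpose (M N : Matrix ι κ ℝ) : frobInner Mᵀ Nᵀ = frobInner M N := by
  rw [frobInner_eq_sum, frobInner_eq_sum, Finset.sum_comm]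
  rfl

lemma frobInner_self_nonneg (M : Matrix ι κ ℝ) : 0 ≤ frobInner M M := by
  rw [frobInner_eq_sum]
  exact Finset.sum_nonneg fun i _ => Finset.sum_nonneg fun j _ => mul_self_nonneg _

lemma frobInner_self_eq_zero {M : Matrix ι κ ℝ} : frobInner M M = 0 ↔ M = 0 := by
  refine ⟨fun h => ?_, fun h => by simp [h]⟩
  rw [frobInner_eq_sum] at h
  ext i j
  have hi := (Finset.sum_eq_zero_iff_of_nonneg
    fun i _ => Finset.sum_nonneg fun j _ => mul_self_nonneg (M i j)).1 h i (Finset.mem_univ i)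
  rw [Finset.sum_eq_zero_iff_of_nonneg fun j _ => mul_self_nonneg (M i j)] at hi
  simpa using hi j (Finset.mem_univ j)

lemma frobInner_mul_transpose (a c : Matrix ι (Fin 1) ℝ) (b d : Matrix κ (Fin 1) ℝ) :
    frobInner (a * bᵀ) (c * dᵀ) = frobInner a c * frobInner b d := by
  simp only [frobInner_eq_sum, Matrix.mul_apply, Finset.univ_unique, Finset.sum_singleton,
    Matrix.transpose_apply, Finset.sum_mul_sum]
  exact Finset.sum_congr rfl fun i _ => Finset.sum_congr rfl fun j _ => by ring

/-- The Frobenius norm of a product is the sum over the columns of the right factor. -/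
lemma frobInner_mul_self_eq_sum_col (M : Matrix ι μ ℝ) (N : Matrix μ κ ℝ) :
    frobInner (M * N) (M * N) = ∑ j, frobInner (M * N.submatrix id fun _ : Fin 1 => j)
      (M * N.submatrix id fun _ : Fin 1 => j) := by
  rw [frobInner_eq_sum, Finset.sum_comm]
  refine Finset.sum_congr rfl fun j _ => ?_
  simp [frobInner_eq_sum, Matrix.mul_apply]

lemma frobInner_self_eq_sum_col (N : Matrix μ κ ℝ) :
    frobInner N N = ∑ j, frobInner (N.submatrix id fun _ : Fin 1 => j)
      (N.submatrix id fun _ : Fin 1 => j) := by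
  classical
  simpa using frobInner_mul_self_eq_sum_col (1 : Matrix μ μ ℝ) N

lemma frobInner_mul_self_le (M : Matrix ι μ ℝ) (N : Matrix μ κ ℝ) :
    frobInner (M * N) (M * N) ≤ frobInner M M * frobInner N N := by
  rw [frobInner_eq_sum, frobInner_eq_sum, frobInner_eq_sum N,
    Finset.sum_comm (f := fun i j => N i j * N i j), Finset.sum_mul_sum]
  refine Finset.sum_le_sum fun i _ => Finset.sum_le_sum fun j _ => ?_
  have := Finset.sum_mul_sq_le_sq_mul_sq Finset.univ (fun k => M i k) (fun k => N k j)
  simpa [Matrix.mul_apply, pow_two] using this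

lemma sq_frobenius_norm (M : Matrix ι κ ℝ) : ‖M‖ ^ 2 = frobInner M M := by
  have h : 0 ≤ ∑ i, ∑ j, ‖M i j‖ ^ (2 : ℝ) := by positivity
  rw [Matrix.frobenius_norm_def, ← Real.sqrt_eq_rpow, Real.sq_sqrt h, frobInner_eq_sum]
  simp [pow_two]

end FrobeniusInner

/-! ### Orthogonal projections onto column spaces -/

section Projection

variable {n k : ℕ}

/-- The normal equations are solvable. -/
lemma exists_transpose_mul_self_mul_eq (M : Matrix (Fin n) (Fin k) ℝ) :
    ∃ K : Matrix (Fin k) (Fin n) ℝ, Mᵀ * M * K = Mᵀ := by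
  have hle : LinearMap.range (Mᵀ * M).mulVecLin ≤ LinearMap.range Mᵀ.mulVecLin := by
    rw [Matrix.mulVecLin_mul]
    exact LinearMap.range_comp_le_range _ _
  -- `MᵀM` and `Mᵀ` have equal rank, so the inclusion of ranges is an equality.
  have heq : LinearMap.range (Mᵀ * M).mulVecLin = LinearMap.range Mᵀ.mulVecLin := by
    refine Submodule.eq_of_le_of_finrank_eq hle ?_
    change (Mᵀ * M).rank = Mᵀ.rank
    rw [Matrix.rank_transpose_mul_self, Matrix.rank_transpose]
  have hcol : ∀ i, ∃ v, (Mᵀ * M) *ᵥ v = Mᵀ.col i := by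
    intro i
    have : Mᵀ.col i ∈ LinearMap.range Mᵀ.mulVecLin := ⟨Pi.single i 1, by simp⟩
    rw [← heq] at this
    exact this
  choose v hv using hcol
  refine ⟨Matrix.of fun a i => v i a, ?_⟩
  ext a i
  exact congrFun (hv i) a

/-- The trace of an idempotent is the dimension of its range. -/
lemma trace_le_of_mul_self_eq {J : Matrix (Fin k) (Fin k) ℝ} (h : J * J = J) : J.trace ≤ k := by
  have hid : IsIdempotentElem (Matrix.toLin' J) := by
    rw [IsIdempotentElem, Module.End.mul_eq_comp, ← Matrix.toLin'_mul, h]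
  have htr := LinearMap.IsProj.trace ((LinearMap.isProj_range_iff_isIdempotentElem _).2 hid)
  rw [Matrix.trace_toLin'_eq] at htr
  rw [htr]
  have := Submodule.finrank_le (LinearMap.range (Matrix.toLin' J))
  simp only [Module.finrank_fin_fun] at this
  exact_mod_cast this

/-- The orthogonal projection onto the column space of `M`, written as `M * K`. -/
lemma exists_orthogonal_projection (M : Matrix (Fin n) (Fin k) ℝ) :
    ∃ K : Matrix (Fin k) (Fin n) ℝ, (M * K)ᵀ = M * K ∧ M * K * M = M ∧ (M * K).trace ≤ k := by
  obtain ⟨K, hK⟩ := exists_transpose_mul_self_mul_eq M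
  have h1 : (M * K)ᵀ * (M * K) = (M * K)ᵀ := by
    rw [Matrix.transpose_mul, Matrix.mul_assoc, ← Matrix.mul_assoc Mᵀ, hK]
  have h2 : (M * K)ᵀ = M * K := by
    have := congrArg Matrix.transpose h1
    rw [Matrix.transpose_mul, Matrix.transpose_transpose, h1] at this
    exact this
  have h3 : M * K * M = M := by
    have := congrArg Matrix.transpose hK
    rw [Matrix.mul_assoc, Matrix.transpose_mul, h2, Matrix.transpose_transpose] at this
    exact this
  refine ⟨K, h2, h3, ?_⟩
  rw [Matrix.trace_mul_comm]
  apply trace_le_of_mul_self_eq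
  rw [Matrix.mul_assoc, ← Matrix.mul_assoc M, h3]

end Projection

/-- Separation of two homogeneous families by one constant. -/
lemma exists_separating_constant {ι κ : Type*} {a b : ι → ℝ} {c d : κ → ℝ} {C : ℝ}
    (ha : ∀ i, 0 ≤ a i) (hb : ∀ i, 0 ≤ b i) (hc : ∀ j, 0 ≤ c j) (hd : ∀ j, 0 ≤ d j)
    (hC : ∀ i, a i ≤ C * b i) (h : ∀ i j, c j * a i ≤ d j * b i) :
    ∃ s, 0 ≤ s ∧ (∀ i, a i ≤ s * b i) ∧ ∀ j, s * c j ≤ d j := by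
  -- The constant is the supremum of the ratios `a i / b i`; `C` serves only to bound them and to
  -- force `a i = 0` where `b i = 0`.
  have hbdd : BddAbove (Set.range fun i => a i / b i) := by
    refine ⟨max C 0, ?_⟩
    rintro _ ⟨i, rfl⟩
    rcases (hb i).eq_or_lt with h0 | h0
    · simp [← h0]
    · exact le_max_of_le_left ((div_le_iff₀ h0).2 (hC i))
  refine ⟨⨆ i, a i / b i, Real.iSup_nonneg fun i => div_nonneg (ha i) (hb i), fun i => ?_, fun j => ?_⟩
  · rcases (hb i).eq_or_lt with h0 | h0
    · have := hC i
      rw [← h0] at this ⊢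
      simpa using this
    · exact (div_le_iff₀ h0).1 (le_ciSup hbdd i)
  · rcases (hc j).eq_or_lt with h0 | h0
    · simpa [← h0] using hd j
    · rw [← le_div_iff₀ h0]
      refine Real.iSup_le (fun i => ?_) (div_nonneg (hd j) h0.le)
      rcases (hb i).eq_or_lt with h1 | h1
      · simpa [← h1] using div_nonneg (hd j) h0.le
      · rw [div_le_div_iff₀ h1 h0]
        linarith [h i j]

/-! ### Loss along curves: first and second order conditions -/

section Loss

variable {d₀ d₁ d₂ m : ℕ} {X : Matrix (Fin d₀) (Fin m) ℝ} {Y : Matrix (Fin d₂) (Fin m) ℝ}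
  {A : Params d₀ d₁ d₂}

lemma loss_eq_frobInner (B : Params d₀ d₁ d₂) :
    loss X Y B = 1 / 2 * frobInner (B.2 * B.1 * X - Y) (B.2 * B.1 * X - Y) := by
  rw [loss, sq_frobenius_norm]

/-- The gradient of the square loss with respect to the product `A₂ A₁`. -/
def productGradient (X : Matrix (Fin d₀) (Fin m) ℝ) (Y : Matrix (Fin d₂) (Fin m) ℝ)
    (A : Params d₀ d₁ d₂) : Matrix (Fin d₂) (Fin d₀) ℝ :=
  (A.2 * A.1 * X - Y) * Xᵀ

lemma loss_eq_of_product_eq (A B : Params d₀ d₁ d₂) {D : Matrix (Fin d₂) (Fin d₀) ℝ}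
    (h : B.2 * B.1 = A.2 * A.1 + D) :
    loss X Y B = loss X Y A +
      (frobInner (productGradient X Y A) D + 1 / 2 * frobInner (D * X) (D * X)) := by
  have h1 : B.2 * B.1 * X - Y = (A.2 * A.1 * X - Y) + D * X := by
    rw [h, Matrix.add_mul]; abel
  rw [loss_eq_frobInner, loss_eq_frobInner, h1, productGradient]
  have h2 := frobInner_mul_right D X (A.2 * A.1 * X - Y)
  rw [frobInner_comm D] at h2
  rw [← h2, frobInner_add_left, frobInner_add_right, frobInner_add_right,
    frobInner_comm (A.2 * A.1 * X - Y) (D * X)]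
  ring

lemma isGlobalMin_of_productGradient_eq_zero (h : productGradient X Y A = 0) :
    IsGlobalMin (loss X Y) A := by
  intro B
  rw [loss_eq_of_product_eq A B (D := B.2 * B.1 - A.2 * A.1) (by abel), h, frobInner_zero_left]
  linarith [frobInner_self_nonneg ((B.2 * B.1 - A.2 * A.1) * X)]

lemma nonneg_of_eventually_pow_mul_nonneg {g : ℝ → ℝ} (hg : Continuous g) (k : ℕ)
    (h : ∀ᶠ t in 𝓝[>] (0 : ℝ), 0 ≤ t ^ k * g t) : 0 ≤ g 0 := by
  refine ge_of_tendsto ((hg.tendsto 0).mono_left nhdsWithin_le_nhds) (b := 0) (a := g 0)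
    (f := g) (x := 𝓝[>] (0 : ℝ)) ?_
  filter_upwards [h, self_mem_nhdsWithin] with t ht h0
  exact nonneg_of_mul_nonneg_right ht (pow_pos h0 k)

/-- At a local minimum, the leading coefficient of the loss along a curve is nonnegative. -/
lemma nonneg_of_isLocalMin (hA : IsLocalMin (loss X Y) A)
    {a : ℝ → Matrix (Fin d₁) (Fin d₀) ℝ} {b : ℝ → Matrix (Fin d₂) (Fin d₁) ℝ}
    (ha : Continuous a) (hb : Continuous b) (ha0 : a 0 = 0) (hb0 : b 0 = 0)
    {g : ℝ → ℝ} (hg : Continuous g) (k : ℕ)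
    (h : ∀ t, frobInner (productGradient X Y A) (A.2 * a t + b t * A.1 + b t * a t) +
      1 / 2 * frobInner ((A.2 * a t + b t * A.1 + b t * a t) * X)
        ((A.2 * a t + b t * A.1 + b t * a t) * X) = t ^ k * g t) : 0 ≤ g 0 := by
  have hc : Continuous fun t => ((A.1 + a t, A.2 + b t) : Params d₀ d₁ d₂) := by fun_prop
  have ht := (hc.tendsto 0).mono_left (nhdsWithin_le_nhds (s := Set.Ioi 0))
  simp only [ha0, hb0, add_zero] at ht
  refine nonneg_of_eventually_pow_mul_nonneg hg k ?_
  filter_upwards [ht.eventually hA] with t hle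
  rw [loss_eq_of_product_eq A (A.1 + a t, A.2 + b t)
    (D := A.2 * a t + b t * A.1 + b t * a t)
    (by simp only [Matrix.add_mul, Matrix.mul_add]; abel), h] at hle
  linarith

/-- `A₂ᵀG` is the partial gradient in `A₁`; moving against it changes the loss by `-t‖A₂ᵀG‖²` to
first order. -/
lemma transpose_mul_productGradient (hA : IsLocalMin (loss X Y) A) :
    A.2ᵀ * productGradient X Y A = 0 := by
  set G := productGradient X Y A with hG
  have := nonneg_of_isLocalMin hA (a := fun t => t • (-(A.2ᵀ * G))) (b := fun _ => 0)
    (g := fun t => frobInner G (A.2 * (-(A.2ᵀ * G))) +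
      t * (1 / 2 * frobInner (A.2 * (-(A.2ᵀ * G)) * X) (A.2 * (-(A.2ᵀ * G)) * X)))
    (by fun_prop) (by fun_prop) (by simp) (by simp) (by fun_prop) 1 (fun t => by
      rw [← hG]
      simp only [Matrix.mul_smul, Matrix.smul_mul, Matrix.zero_mul, smul_zero, add_zero,
        frobInner_smul_right, frobInner_smul_left]
      ring)
  rw [zero_mul, add_zero, Matrix.mul_neg, frobInner_neg_right, frobInner_comm,
    frobInner_mul_left] at this
  exact frobInner_self_eq_zero.1 (le_antisymm (by linarith) (frobInner_self_nonneg _))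

lemma productGradient_mul_transpose (hA : IsLocalMin (loss X Y) A) :
    productGradient X Y A * A.1ᵀ = 0 := by
  set G := productGradient X Y A with hG
  have := nonneg_of_isLocalMin hA (a := fun _ => 0) (b := fun t => t • (-(G * A.1ᵀ)))
    (g := fun t => frobInner G ((-(G * A.1ᵀ)) * A.1) +
      t * (1 / 2 * frobInner ((-(G * A.1ᵀ)) * A.1 * X) ((-(G * A.1ᵀ)) * A.1 * X)))
    (by fun_prop) (by fun_prop) (by simp) (by simp) (by fun_prop) 1 (fun t => by
      rw [← hG]
      simp only [Matrix.smul_mul, Matrix.mul_zero, add_zero, zero_add,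
        frobInner_smul_right, frobInner_smul_left]
      ring)
  rw [zero_mul, add_zero, Matrix.neg_mul, frobInner_neg_right, frobInner_comm,
    frobInner_mul_right] at this
  exact frobInner_self_eq_zero.1 (le_antisymm (by linarith) (frobInner_self_nonneg _))

/-- At a local minimum whose second layer is not injective the gradient with respect to the
product vanishes. -/
lemma productGradient_eq_zero_of_mul_eq_zero (hA : IsLocalMin (loss X Y) A)
    {u : Matrix (Fin d₁) (Fin 1) ℝ} (hu : u ≠ 0) (hAu : A.2 * u = 0) :
    productGradient X Y A = 0 := by
  have hGA := productGradient_mul_transpose hA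
  set G := productGradient X Y A with hG
  have hv : ∀ v : Matrix (Fin d₀) (Fin 1) ℝ, G * v = 0 := by
    intro v
    -- With `A₁` moved at order `t` and `A₂` at order `t²`, the terms `A₂a` and `⟨G, bA₁⟩` vanish
    -- and the quadratic part is of order `t⁴`. The `t³` coefficient is `-‖u‖²‖Gv‖²`.
    set b := -(G * v * uᵀ) with hb
    have h0 : frobInner G (b * A.1) = 0 := by
      rw [frobInner_comm, frobInner_mul_right, hGA, frobInner_zero_right]
    have := nonneg_of_isLocalMin hA (a := fun t => t • (u * vᵀ)) (b := fun t => t ^ 2 • b)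
      (g := fun t => frobInner G (b * (u * vᵀ)) +
        t * (1 / 2 * frobInner ((b * A.1 + t • (b * (u * vᵀ))) * X)
          ((b * A.1 + t • (b * (u * vᵀ))) * X)))
      (by fun_prop) (by fun_prop) (by simp) (by simp)
      (by
        simp only [Matrix.add_mul, Matrix.smul_mul, frobInner_add_left, frobInner_add_right,
          frobInner_smul_left, frobInner_smul_right]
        fun_prop) 3 (fun t => by
        rw [← hG, Matrix.mul_smul, ← Matrix.mul_assoc, hAu, Matrix.zero_mul, smul_zero, zero_add]
        simp only [Matrix.mul_smul, Matrix.smul_mul, Matrix.add_mul, frobInner_add_left,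
          frobInner_add_right, frobInner_smul_right, frobInner_smul_left, h0]
        ring)
    rw [zero_mul, add_zero, ← Matrix.mul_assoc, frobInner_comm, frobInner_mul_right,
      Matrix.transpose_transpose, hb, Matrix.neg_mul, frobInner_neg_left, Matrix.mul_assoc _ uᵀ] at this
    have h1 : G * v * (uᵀ * u) = frobInner u u • (G * v) := by
      ext i j
      fin_cases j
      simp [Matrix.mul_apply, frobInner_eq_sum, Finset.mul_sum, mul_comm]
    rw [h1, frobInner_smul_left] at this
    have hpos : 0 < frobInner u u :=
      lt_of_le_of_ne (frobInner_self_nonneg u) fun h => hu (frobInner_self_eq_zero.1 h.symm)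
    refine frobInner_self_eq_zero.1 (le_antisymm ?_ (frobInner_self_nonneg _))
    by_contra! hlt
    linarith [mul_pos hpos hlt]
  ext i j
  have := congrFun (congrFun (hv (Matrix.of fun k _ => if k = j then 1 else 0)) i) 0
  simpa [Matrix.mul_apply] using this

/-- The second order condition at a local minimum, in the rank one directions
`(w vᵀ, e uᵀ)` with `e` orthogonal to the range of the second layer. -/
lemma second_order_of_isLocalMin (hA : IsLocalMin (loss X Y) A)
    (u w : Matrix (Fin d₁) (Fin 1) ℝ) (v : Matrix (Fin d₀) (Fin 1) ℝ)
    {e : Matrix (Fin d₂) (Fin 1) ℝ} (he : A.2ᵀ * e = 0) :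
    0 ≤ frobInner u w * frobInner e (productGradient X Y A * v) +
      1 / 2 * (frobInner (A.2 * w) (A.2 * w) * frobInner (Xᵀ * v) (Xᵀ * v) +
        frobInner e e * frobInner (Xᵀ * (A.1ᵀ * u)) (Xᵀ * (A.1ᵀ * u))) := by
  have hGA := productGradient_mul_transpose hA
  have hBG := transpose_mul_productGradient hA
  set G := productGradient X Y A with hG
  set a := w * vᵀ with ha
  set b := e * uᵀ with hb
  have h0 : frobInner G (b * A.1) = 0 := by
    rw [frobInner_comm, frobInner_mul_right, hGA, frobInner_zero_right]
  have h1 : frobInner G (A.2 * a) = 0 := by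
    rw [frobInner_comm, frobInner_mul_left, hBG, frobInner_zero_right]
  have := nonneg_of_isLocalMin hA (a := fun t => t • a) (b := fun t => t • b)
    (g := fun t => frobInner G (b * a) +
      1 / 2 * frobInner ((A.2 * a + b * A.1 + t • (b * a)) * X)
          ((A.2 * a + b * A.1 + t • (b * a)) * X))
    (by fun_prop) (by fun_prop) (by simp) (by simp)
    (by
      simp only [Matrix.add_mul, Matrix.smul_mul, frobInner_add_left, frobInner_add_right,
        frobInner_smul_left, frobInner_smul_right]
      fun_prop) 2 (fun t => by
      rw [← hG]
      simp only [Matrix.mul_smul, Matrix.smul_mul, Matrix.add_mul, frobInner_add_left,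
        frobInner_add_right, frobInner_smul_right, frobInner_smul_left, h0, h1]
      ring)
  have h2 : A.2 * a * X = A.2 * w * (Xᵀ * v)ᵀ := by
    rw [ha, Matrix.transpose_mul, Matrix.transpose_transpose]; simp only [Matrix.mul_assoc]
  have h3 : b * A.1 * X = e * (Xᵀ * (A.1ᵀ * u))ᵀ := by
    rw [hb]
    simp only [Matrix.transpose_mul, Matrix.transpose_transpose, Matrix.mul_assoc]
  -- Orthogonality of the two rank one terms removes the mixed term of the quadratic part.
  have h4 : frobInner (A.2 * w) e = 0 := by
    rw [frobInner_mul_left, he, frobInner_zero_right]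
  have h5 : frobInner G (b * a) = frobInner u w * frobInner e (G * v) := by
    rw [ha, ← Matrix.mul_assoc, frobInner_comm, frobInner_mul_right, Matrix.transpose_transpose,
      hb, Matrix.mul_assoc]
    have : frobInner (e * (uᵀ * w)) (G * v) = frobInner (uᵀ * w) (eᵀ * (G * v)) :=
      frobInner_mul_left _ _ _
    rw [this]
    simp [frobInner_eq_sum, Matrix.mul_apply]
  simp only [zero_smul, add_zero, h5, Matrix.add_mul, h2, h3, frobInner_add_left,
    frobInner_add_right, frobInner_mul_transpose, h4, frobInner_comm e (A.2 * w)] at this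
  linarith

end Loss

/-! ### Best low-rank approximation -/

section LowRank

variable {n m : ℕ}

lemma frobInner_projection {Q : Matrix (Fin n) (Fin n) ℝ} (hQ : Qᵀ = Q) (hQQ : Q * Q = Q)
    (M : Matrix (Fin n) (Fin m) ℝ) :
    frobInner M M = frobInner (Q * M) (Q * M) + frobInner ((1 - Q) * M) ((1 - Q) * M) := by
  have h : frobInner (Q * M) (Q * M) = frobInner M (Q * M) := by
    rw [frobInner_mul_left, hQ, ← Matrix.mul_assoc, hQQ]
  rw [Matrix.sub_mul, Matrix.one_mul, frobInner_sub_left, frobInner_sub_right,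
    frobInner_sub_right, frobInner_comm (Q * M) M, h]
  ring

/-- Among the projections `Q` of rank at most that of `P`, the range of `P` captures the most of
`Z + E`, if `Z` lives on the range of `P`, where its singular values are at least `√s`, and `E`
lives on the complement, where its singular values are at most `√s`. -/
lemma frobInner_le_of_projection {Z E : Matrix (Fin n) (Fin m) ℝ} {P Q : Matrix (Fin n) (Fin n) ℝ}
    (hP : Pᵀ = P) (hPP : P * P = P) (hQ : Qᵀ = Q) (hQQ : Q * Q = Q) (htr : Q.trace ≤ P.trace)
    (hPE : P * E = 0) (hEZ : E * Zᵀ = 0) {s : ℝ} (hs : 0 ≤ s)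
    (hE : ∀ N : Matrix (Fin n) (Fin n) ℝ, P * N = 0 →
      frobInner (Eᵀ * N) (Eᵀ * N) ≤ s * frobInner N N)
    (hZ : ∀ N : Matrix (Fin n) (Fin n) ℝ,
      s * frobInner (P * N) (P * N) ≤ frobInner (Zᵀ * N) (Zᵀ * N)) :
    frobInner E E ≤ frobInner ((1 - Q) * (Z + E)) ((1 - Q) * (Z + E)) := by
  have hQ' : (1 - Q)ᵀ = 1 - Q := by simp [hQ]
  have hZt : ∀ T : Matrix (Fin n) (Fin n) ℝ, Tᵀ = T → ∀ F : Matrix (Fin n) (Fin m) ℝ,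
      frobInner (T * F) (T * F) = frobInner (Fᵀ * T) (Fᵀ * T) := by
    intro T hT F
    rw [← frobInner_transpose (T * F), Matrix.transpose_mul, hT]
  have hcross : frobInner ((1 - Q) * Z) ((1 - Q) * E) = 0 := by
    rw [frobInner, Matrix.trace_mul_comm, Matrix.transpose_mul, Matrix.mul_assoc,
      ← Matrix.mul_assoc E, hEZ, Matrix.zero_mul, Matrix.mul_zero, Matrix.trace_zero]
  have h1 : frobInner (Eᵀ * Q) (Eᵀ * Q) ≤ s * frobInner ((1 - P) * Q) ((1 - P) * Q) := by
    have h := hE ((1 - P) * Q) (by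
      rw [← Matrix.mul_assoc, Matrix.mul_sub, hPP, Matrix.mul_one, sub_self, Matrix.zero_mul])
    have hEP : Eᵀ * P = 0 := by
      have := congrArg Matrix.transpose hPE
      simpa [hP] using this
    rwa [← Matrix.mul_assoc, Matrix.mul_sub, hEP, Matrix.mul_one, sub_zero] at h
  have h2 := hZ (1 - Q)
  have h3 := frobInner_projection hQ hQQ E
  -- The two sides differ by `tr P - tr Q`: what `Q` gains outside `P` is at most what it loses
  -- inside.
  have h4 : frobInner ((1 - P) * Q) ((1 - P) * Q) ≤ frobInner (P * (1 - Q)) (P * (1 - Q)) := by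
    have e1 : frobInner ((1 - P) * Q) ((1 - P) * Q) = Q.trace - (P * Q).trace := by
      rw [frobInner, Matrix.transpose_mul, Matrix.transpose_sub, Matrix.transpose_one, hP, hQ,
        ← Matrix.mul_assoc, Matrix.trace_mul_comm]
      have : Q * (Q * (1 - P) * (1 - P)) = Q * (1 - P) := by
        rw [← Matrix.mul_assoc, ← Matrix.mul_assoc, hQQ, Matrix.mul_assoc]
        congr 1
        simp [Matrix.mul_sub, Matrix.sub_mul, hPP]
      rw [this, Matrix.mul_sub, Matrix.mul_one, Matrix.trace_sub, Matrix.trace_mul_comm Q P]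
    have e2 : frobInner (P * (1 - Q)) (P * (1 - Q)) = P.trace - (P * Q).trace := by
      rw [frobInner, Matrix.transpose_mul, hQ', hP, ← Matrix.mul_assoc, Matrix.trace_mul_comm]
      have : (1 - Q) * ((1 - Q) * P * P) = (1 - Q) * P := by
        rw [Matrix.mul_assoc (1 - Q), hPP, ← Matrix.mul_assoc]
        congr 1
        simp [Matrix.mul_sub, Matrix.sub_mul, hQQ]
      rw [this, Matrix.sub_mul, Matrix.one_mul, Matrix.trace_sub, Matrix.trace_mul_comm Q P]
    rw [e1, e2]
    linarith
  have h5 := mul_le_mul_of_nonneg_left h4 hs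
  rw [Matrix.mul_add, frobInner_add_left, frobInner_add_right, frobInner_add_right, hcross,
    frobInner_comm ((1 - Q) * E) ((1 - Q) * Z), hcross, hZt _ hQ' Z]
  rw [hZt _ hQ E] at h3
  linarith

/-- Pythagoras for the projection `P` onto the row space of `X`. -/
lemma frobInner_sub_eq_of_row_projection {k : ℕ} {X : Matrix (Fin k) (Fin m) ℝ}
    {P : Matrix (Fin m) (Fin m) ℝ} (hP : Pᵀ = P) (hPP : P * P = P) (hXP : X * P = X)
    (W : Matrix (Fin n) (Fin k) ℝ) (Y : Matrix (Fin n) (Fin m) ℝ) :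
    frobInner (W * X - Y) (W * X - Y) =
      frobInner (W * X - Y * P) (W * X - Y * P) + frobInner (Y * P - Y) (Y * P - Y) := by
  have h1 : W * X - Y = (W * X - Y * P) + (Y * P - Y) := by abel
  have h2 : W * X - Y * P = (W * X - Y) * P := by rw [Matrix.sub_mul, Matrix.mul_assoc, hXP]
  have h3 : frobInner (W * X - Y * P) (Y * P - Y) = 0 := by
    rw [h2, frobInner_mul_right, hP, Matrix.sub_mul, Matrix.mul_assoc, hPP, sub_self,
      frobInner_zero_right]
  conv_lhs => rw [h1]
  rw [frobInner_add_left, frobInner_add_right, frobInner_add_right, h3,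
    frobInner_comm (Y * P - Y), h3]
  ring

end LowRank

/-! ### Global minimality and saddle points -/

section Main

variable {d₀ d₁ d₂ m : ℕ} {X : Matrix (Fin d₀) (Fin m) ℝ} {Y : Matrix (Fin d₂) (Fin m) ℝ}
  {A : Params d₀ d₁ d₂}

lemma isGlobalMin_of_isLocalMin_of_injective (hA : IsLocalMin (loss X Y) A)
    (hinj : ∀ u : Matrix (Fin d₁) (Fin 1) ℝ, A.2 * u = 0 → u = 0) :
    IsGlobalMin (loss X Y) A := by
  have hGA := productGradient_mul_transpose hA
  have hBG := transpose_mul_productGradient hA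
  obtain ⟨K, hPs, hPB, -⟩ := exists_orthogonal_projection A.2
  obtain ⟨L, hXs, hXX, -⟩ := exists_orthogonal_projection Xᵀ
  set P := A.2 * K with hP
  set PX := Xᵀ * L with hPX
  have hPP : P * P = P := by
    conv_lhs => rw [hP, ← Matrix.mul_assoc, ← hP, hPB, ← hP]
  have hPXPX : PX * PX = PX := by
    conv_lhs => rw [hPX, ← Matrix.mul_assoc, ← hPX, hXX, ← hPX]
  have hXPX : X * PX = X := by
    have := congrArg Matrix.transpose hXX
    simpa [hXs] using this
  have hPK : P = Kᵀ * A.2ᵀ := by rw [← Matrix.transpose_mul, ← hP, hPs]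
  have hAP : A.2ᵀ * P = A.2ᵀ := by
    have := congrArg Matrix.transpose hPB
    simpa [hPs] using this
  -- Injectivity makes `K` a left inverse of `A₂`, so `P` has the largest rank open to any
  -- competitor.
  have htrP : P.trace = d₁ := by
    have hKB : K * A.2 = 1 := by
      ext i j
      have := hinj ((K * A.2 - 1).submatrix id fun _ => j) (by
        have h : A.2 * (K * A.2 - 1) = 0 := by
          rw [Matrix.mul_sub, ← Matrix.mul_assoc, ← hP, hPB, Matrix.mul_one, sub_self]
        ext a b
        exact congrFun (congrFun h a) j)
      have := congrFun (congrFun this i) 0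
      simpa [sub_eq_zero] using this
    rw [hP, Matrix.trace_mul_comm, hKB]
    simp
  set W := A.2 * A.1 with hW
  set G := productGradient X Y A with hG
  set E := Y * PX - W * X with hE
  have hEG : E = -(G * L) := by
    rw [hE, hG, productGradient, Matrix.mul_assoc (_ - Y), ← hPX, ← hW, Matrix.sub_mul, Matrix.mul_assoc W,
      hXPX, neg_sub]
  have hEX : E * Xᵀ = -G := by
    rw [hE, hG, productGradient, Matrix.sub_mul, Matrix.sub_mul, Matrix.mul_assoc Y, hXX, neg_sub]
  have hBE : A.2ᵀ * E = 0 := by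
    rw [hEG, Matrix.mul_neg, ← Matrix.mul_assoc, hBG, Matrix.zero_mul, neg_zero]
  have hEZ : E * (W * X)ᵀ = 0 := by
    rw [Matrix.transpose_mul, ← Matrix.mul_assoc, hEX, hW, Matrix.transpose_mul,
      ← Matrix.mul_assoc, Matrix.neg_mul, hGA, neg_zero, Matrix.zero_mul]
  -- The rows of `E` lie in the row space of `X`, so `Eᵀe` has the form `Xᵀv` needed in the second
  -- order condition.
  have hrow : Eᵀ = Xᵀ * (L * Eᵀ) := by
    have : E * PX = E := by
      rw [hE, Matrix.sub_mul, Matrix.mul_assoc, hPXPX, Matrix.mul_assoc, hXPX]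
    rw [← Matrix.mul_assoc, ← hPX]
    conv_lhs => rw [← this, Matrix.transpose_mul, hXs]
  have hsep : ∀ (e : {e : Matrix (Fin d₂) (Fin 1) ℝ // P * e = 0})
      (y : Matrix (Fin d₂) (Fin 1) ℝ),
      frobInner (P * y) (P * y) * frobInner (Eᵀ * e.1) (Eᵀ * e.1) ≤
        frobInner ((W * X)ᵀ * y) ((W * X)ᵀ * y) * frobInner e.1 e.1 := by
    rintro ⟨e, he⟩ y
    have he' : A.2ᵀ * e = 0 := by rw [← hAP, Matrix.mul_assoc, he, Matrix.mul_zero]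
    -- With `w = Ky`, `A₂w` is the projection `Py`; the first term is then `-‖Py‖²‖Eᵀe‖²`, half of
    -- which the quadratic part cancels.
    have h := second_order_of_isLocalMin hA (A.2ᵀ * y) (K * y) (L * Eᵀ * e) he'
    have e1 : frobInner (A.2ᵀ * y) (K * y) = frobInner (P * y) (P * y) := by
      rw [frobInner_mul_left, Matrix.transpose_transpose, ← Matrix.mul_assoc, ← hP,
        frobInner_mul_left, hPs, ← Matrix.mul_assoc, hPP]
    have e2 : Xᵀ * (L * Eᵀ * e) = Eᵀ * e := by
      rw [← Matrix.mul_assoc, ← hrow]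
    have e3 : frobInner e (G * (L * Eᵀ * e)) = -frobInner (Eᵀ * e) (Eᵀ * e) := by
      have : G * (L * Eᵀ * e) = -(E * (Eᵀ * e)) := by
        rw [← neg_eq_iff_eq_neg, ← Matrix.neg_mul, ← hEX, Matrix.mul_assoc, e2]
      rw [this, frobInner_neg_right, frobInner_mul_left, Matrix.transpose_transpose]
    have e4 : Xᵀ * (A.1ᵀ * (A.2ᵀ * y)) = (W * X)ᵀ * y := by
      rw [hW]; simp only [Matrix.transpose_mul, Matrix.mul_assoc]
    rw [← hG, e1, e2, e3, e4, ← Matrix.mul_assoc, ← hP] at h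
    linarith
  obtain ⟨s, hs, hs1, hs2⟩ : ∃ s : ℝ, 0 ≤ s ∧
      (∀ e : {e : Matrix (Fin d₂) (Fin 1) ℝ // P * e = 0},
        frobInner (Eᵀ * e.1) (Eᵀ * e.1) ≤ s * frobInner e.1 e.1) ∧
      ∀ y : Matrix (Fin d₂) (Fin 1) ℝ, s * frobInner (P * y) (P * y) ≤
        frobInner ((W * X)ᵀ * y) ((W * X)ᵀ * y) :=
    exists_separating_constant (C := frobInner Eᵀ Eᵀ)
      (fun e => frobInner_self_nonneg _) (fun e => frobInner_self_nonneg _)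
      (fun y => frobInner_self_nonneg _) (fun y => frobInner_self_nonneg _)
      (fun e => frobInner_mul_self_le _ _) hsep
  intro B
  obtain ⟨J, hQs, hQB, htrQ⟩ := exists_orthogonal_projection B.2
  set Q := B.2 * J with hQ
  have hQQ : Q * Q = Q := by
    conv_lhs => rw [hQ, ← Matrix.mul_assoc, ← hQ, hQB, ← hQ]
  have key := frobInner_le_of_projection (Z := W * X) (E := E) hPs hPP hQs hQQ
    (by rw [htrP]; exact htrQ) (by rw [hPK, Matrix.mul_assoc, hBE, Matrix.mul_zero]) hEZ hs
    (fun N hN => by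
      rw [frobInner_mul_self_eq_sum_col, frobInner_self_eq_sum_col N, Finset.mul_sum]
      refine Finset.sum_le_sum fun j _ => hs1 ⟨_, ?_⟩
      ext a b
      exact congrFun (congrFun hN a) j)
    (fun N => by
      rw [frobInner_mul_self_eq_sum_col, frobInner_mul_self_eq_sum_col (W * X)ᵀ, Finset.mul_sum]
      exact Finset.sum_le_sum fun j _ => hs2 _)
  have hproj := frobInner_projection hQs hQQ (B.2 * B.1 * X - Y * PX)
  -- `1 - Q` annihilates the competitor's output, so this part of its error does not depend on
  -- `B.1`.
  have hres : (1 - Q) * (B.2 * B.1 * X - Y * PX) = -((1 - Q) * (W * X + E)) := by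
    have h1 : (1 - Q) * (B.2 * B.1 * X) = 0 := by
      rw [Matrix.sub_mul, Matrix.one_mul, ← Matrix.mul_assoc, ← Matrix.mul_assoc, hQB, sub_self]
    rw [Matrix.mul_sub, h1, zero_sub, hE]
    congr 2
    abel
  rw [hres, frobInner_neg_left, frobInner_neg_right, neg_neg] at hproj
  have hpos := frobInner_self_nonneg (Q * (B.2 * B.1 * X - Y * PX))
  have hEE : frobInner (W * X - Y * PX) (W * X - Y * PX) = frobInner E E := by
    rw [hE, ← neg_sub (Y * PX), frobInner_neg_left, frobInner_neg_right, neg_neg]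
  rw [loss_eq_frobInner, loss_eq_frobInner, ← hW,
    frobInner_sub_eq_of_row_projection hXs hPXPX hXPX W,
    frobInner_sub_eq_of_row_projection hXs hPXPX hXPX (B.2 * B.1), hEE]
  linarith

/-- Every local minimum of the square loss is a global minimum. -/
lemma isGlobalMin_of_isLocalMin (hA : IsLocalMin (loss X Y) A) : IsGlobalMin (loss X Y) A := by
  by_cases h : ∀ u : Matrix (Fin d₁) (Fin 1) ℝ, A.2 * u = 0 → u = 0
  · exact isGlobalMin_of_isLocalMin_of_injective hA h
  · push Not at h
    obtain ⟨u, hAu, hu⟩ := h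
    exact isGlobalMin_of_productGradient_eq_zero
      (productGradient_eq_zero_of_mul_eq_zero hA hu hAu)

lemma loss_scale (t : ℝ) : loss X Y (A.1, A.2 + t • A.2) = loss X Y A +
    (t * frobInner (productGradient X Y A) (A.2 * A.1) +
      t ^ 2 * (1 / 2 * frobInner (A.2 * A.1 * X) (A.2 * A.1 * X))) := by
  rw [loss_eq_of_product_eq A _ (D := t • (A.2 * A.1)) (by
    simp only [Matrix.add_mul, Matrix.smul_mul])]
  simp only [Matrix.smul_mul, frobInner_smul_left, frobInner_smul_right]
  ring

/-- At a critical point the derivative of the loss along the scaling of the second layer is zero. -/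
lemma frobInner_productGradient_eq_zero (hA : IsCriticalPoint (loss X Y) A) :
    frobInner (productGradient X Y A) (A.2 * A.1) = 0 := by
  have hline : HasDerivAt (fun t : ℝ => A.2 + t • A.2) A.2 0 := by
    have h := ((hasDerivAt_id (0 : ℝ)).smul_const A.2).const_add A.2
    rw [one_smul] at h
    exact h
  have h1 : HasDerivAt (fun t : ℝ => loss X Y (A.1, A.2 + t • A.2)) 0 0 := by
    have h := hA.2
    rw [show A.2 = A.2 + (0 : ℝ) • A.2 by simp] at h
    exact HasFDerivAt.comp_hasDerivAt (0 : ℝ) h hline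
  set c := frobInner (productGradient X Y A) (A.2 * A.1)
  set q := 1 / 2 * frobInner (A.2 * A.1 * X) (A.2 * A.1 * X)
  have h2 : HasDerivAt (fun t : ℝ => loss X Y A + (t * c + t ^ 2 * q)) c 0 := by
    have := (((hasDerivAt_id (0 : ℝ)).mul_const c).add
      (((hasDerivAt_id (0 : ℝ)).pow 2).mul_const q)).const_add (loss X Y A)
    simpa using this
  simp only [loss_scale] at h1
  exact h2.unique h1

/-- Along `(1 + t)A₂` the loss is quadratic in `t`; criticality removes the linear term, and `A₂A₁X
≠ 0` makes the quadratic coefficient positive. -/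
lemma exists_higher_of_isCriticalPoint (hA : IsCriticalPoint (loss X Y) A)
    (hne : A.2 * A.1 * X ≠ 0) {U : Set (Params d₀ d₁ d₂)} (hU : U ∈ 𝓝 A) :
    ∃ B ∈ U, loss X Y A < loss X Y B := by
  have hc : Continuous fun t : ℝ => ((A.1, A.2 + t • A.2) : Params d₀ d₁ d₂) := by fun_prop
  have ht := (hc.tendsto 0).mono_left (nhdsWithin_le_nhds (s := Set.Ioi 0))
  simp only [zero_smul, add_zero] at ht
  obtain ⟨t, htU, ht0⟩ := ((ht.eventually hU).and self_mem_nhdsWithin).exists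
  refine ⟨_, htU, ?_⟩
  have hpos : 0 < frobInner (A.2 * A.1 * X) (A.2 * A.1 * X) :=
    lt_of_le_of_ne (frobInner_self_nonneg _) fun h => hne (frobInner_self_eq_zero.1 h.symm)
  rw [loss_scale, frobInner_productGradient_eq_zero hA]
  have : 0 < t := ht0
  have : 0 < t ^ 2 * (1 / 2 * frobInner (A.2 * A.1 * X) (A.2 * A.1 * X)) := by positivity
  linarith

end Main

end ShallowLinear

theorem theorem2 (d₀ d₁ d₂ m : ℕ) (X : Matrix (Fin d₀) (Fin m) ℝ)
    (Y : Matrix (Fin d₂) (Fin m) ℝ) :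
    (∀ A : ShallowLinear.Params d₀ d₁ d₂,
      IsLocalMin (ShallowLinear.loss X Y) A → ShallowLinear.IsGlobalMin (ShallowLinear.loss X Y) A) ∧
    (∀ A : ShallowLinear.Params d₀ d₁ d₂,
      ShallowLinear.IsCriticalPoint (ShallowLinear.loss X Y) A →
      ¬ ShallowLinear.IsGlobalMin (ShallowLinear.loss X Y) A →
      A.2 * A.1 * X ≠ 0 →
      ShallowLinear.IsSaddlePoint (ShallowLinear.loss X Y) A) := by
  refine ⟨fun A hA => ShallowLinear.isGlobalMin_of_isLocalMin hA,
    fun A hcrit hglob hne => ⟨hcrit, fun U hU => ⟨?_,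
      ShallowLinear.exists_higher_of_isCriticalPoint hcrit hne hU⟩⟩⟩
  -- A neighbourhood without lower values would make `A` a local, hence global, minimum.
  by_contra! h
  exact hglob (ShallowLinear.isGlobalMin_of_isLocalMin (Filter.mem_of_superset hU h))
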